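/- A pushdown automaton (PDA) $P=(Q,\Sigma,\Gamma,\delta,q_0,Z_0,F)$ has finite $Q,\Sigma,\Gamma$ and $\delta:Q\times(\Sigma\cup\{\varepsilon\})\times\Gamma\to 2^{Q\times\Gamma^{\le 2}}$. It starts in the configuration $(q_0,Z_0)$ and accepts by final state; $L(P)$ is its language. For a computable $f:\mathbb N\to\mathbb N$, the $f(n)$-parameterised explorability game on $P$ is played as follows. Spoiler announces $n\in\mathbb N$, and $f(n)$ tokens are placed on the initial configuration. In each round (at most $n$ rounds) Spoiler chooses a letter $x\in\Sigma$, and Determiner moves every token along a path of $P$ of the form $\xrightarrow{\varepsilon}\cdots\xrightarrow{\varepsilon}\xrightarrow{x}$ (she loses if she cannot). Determiner wins if, for every prefix $w$ (possibly empty or the whole word) of the word played with $w\in L(P)$, some token is in a state of $F$ after the rounds of $w$. $P$ is $f(n)$-explorable if Determiner has a winning strategy. For a class $C$ of functions, $\mathsf{Expl}_C\text{-}\mathsf{CFL}$ is the class of languages $L(P)$ of PDAs $P$ that are $f(n)$-explorable for some computable $f\in C$. Let $$L_{block}=\{a^{\ell_1}\#a^{\ell_2}\#\cdots a^{\ell_m}\#\,b^{\ell}\;:\;m\ge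 1,\ \ell_1,\dots,\ell_m\ge 0,\ \ell\in\{\ell_1,\dots,\ell_m\}\}\subseteq\{a,b,\#\}^*.$$ **Lemma.** $\mathsf{Expl}_{O(1)}\text{-}\mathsf{CFL}\subsetneq\mathsf{Expl}_{O(n)}\text{-}\mathsf{CFL}$: the inclusion holds over every finite alphabet, and it is strict over $\{a,b,\#\}$, since $L_{block}\in\mathsf{Expl}_{O(n)}\text{-}\mathsf{CFL}$ and $L_{block}\notin\mathsf{Expl}_{O(1)}\text{-}\mathsf{CFL}$. Moreover, one token per $a$-block suffices: there is a PDA $P$ with $L(P)=L_{block}$ such that, for every $n$, Determiner has a winning strategy with $n$ tokens in the game in which Spoiler announces $n$, and under this strategy, for every word $w$ of length at most $n$ and every $i\in\{1,\dots,n\}$, token $i$ is in an accepting state after $w$ if and only if $w=a^{\ell_1}\#\cdots a^{\ell_m}\#\,b^{\ell}$ for some $m\ge i$ with $\ell=\ell_i$. -/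

import Mathlib

/-- A pushdown automaton with states `Q`, input alphabet `A` and stack alphabet `G`
(finiteness of these types is imposed where automata are quantified over).
`(q', γ) ∈ δ q o X` means: in state `q` with `X` on top of the stack, the automaton may read `o`
(`none` is the empty word), move to `q'` and replace `X` by the word `γ` of length at most two. -/
structure PDA (Q A G : Type) where
  δ : Q → Option A → G → Set (Q × List G)
  length_le_two : ∀ q o X q' γ, (q', γ) ∈ δ q o X → γ.length ≤ 2
  q₀ : Q
  Z₀ : G
  F : Set Q

namespace PDA

variable {Q A G : Type}

/-- A configuration: a state and a stack content, the head of the list being the top. -/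
abbrev Conf (Q G : Type) : Type := Q × List G

/-- The initial configuration. -/
def init (P : PDA Q A G) : Conf Q G := (P.q₀, [P.Z₀])

/-- A single transition, labelled by a letter or by `none` for the empty word. No transition
is possible from an empty stack. -/
inductive Step (P : PDA Q A G) : Conf Q G → Option A → Conf Q G → Prop
  | mk {q q' : Q} {o : Option A} {X : G} {γ β : List G} (h : (q', γ) ∈ P.δ q o X) :
      Step P (q, X :: β) o (q', γ ++ β)

/-- `P.Run c w d`: some run leads from `c` to `d` reading `w`; transitions reading the empty word
may occur anywhere. -/
inductive Run (P : PDA Q A G) : Conf Q G → List A → Conf Q G → Prop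
  | refl (c : Conf Q G) : Run P c [] c
  | eps {c c' d : Conf Q G} {w : List A} (h : P.Step c none c') (t : Run P c' w d) : Run P c w d
  | read {c c' d : Conf Q G} {a : A} {w : List A} (h : P.Step c (some a) c') (t : Run P c' w d) :
      Run P c (a :: w) d

/-- The language of `P`, acceptance being by final state. -/
def language (P : PDA Q A G) : Language A :=
  {w | ∃ d : Conf Q G, P.Run P.init w d ∧ d.1 ∈ P.F}

/-- A legal move of one token in a round with letter `a`: finitely many transitions reading the
empty word, followed by one transition reading `a`. -/
def TokenMove (P : PDA Q A G) (c : Conf Q G) (a : A) (d : Conf Q G) : Prop :=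
  ∃ c' : Conf Q G, Relation.ReflTransGen (fun x y => P.Step x none y) c c' ∧ P.Step c' (some a) d

/-- A strategy of Determiner with `k` tokens: the positions of the tokens after Spoiler has played
a given word. (Determiner's own earlier choices are determined by the strategy and the
prefixes of that word, so they need not be arguments.) -/
abbrev Strategy (Q A G : Type) (k : ℕ) : Type := List A → Fin k → Conf Q G

/-- The strategy `σ` is legal, and winning for Determiner, in the game with `k` tokens in which
Spoiler plays at most `n` letters. -/
structure IsWinning (P : PDA Q A G) (n : ℕ) {k : ℕ} (σ : Strategy Q A G k) : Prop where
  start : ∀ l : Fin k, σ [] l = P.init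
  move : ∀ (w : List A) (a : A), w.length < n → ∀ l : Fin k, P.TokenMove (σ w l) a (σ (w ++ [a]) l)
  win : ∀ w : List A, w.length ≤ n → w ∈ P.language → ∃ l : Fin k, (σ w l).1 ∈ P.F

/-- `P` is `f(n)`-explorable: whatever bound `n` Spoiler announces, Determiner has a winning
strategy with `f n` tokens. -/
def IsExplorable (P : PDA Q A G) (f : ℕ → ℕ) : Prop :=
  ∀ n : ℕ, ∃ σ : Strategy Q A G (f n), P.IsWinning n σ

end PDA

/-- The class of languages over `A` recognised by an `f(n)`-explorable pushdown automaton for some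
computable function `f` in `C`. -/
def ExplCFL (A : Type) (C : Set (ℕ → ℕ)) : Set (Language A) :=
  {L | ∃ f : ℕ → ℕ, Computable f ∧ f ∈ C ∧
    ∃ (Q G : Type) (_ : Finite Q) (_ : Finite G) (P : PDA Q A G),
      P.language = L ∧ P.IsExplorable f}

/-- The class `O(g)` of functions on the natural numbers. -/
def BigO (g : ℕ → ℕ) : Set (ℕ → ℕ) :=
  {f | (fun n => (f n : ℝ)) =O[Filter.atTop] (fun n => (g n : ℝ))}

/-- The three-letter alphabet `{a, b, #}`. -/
inductive Letter : Type
  | a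
  | b
  | sharp
  deriving DecidableEq

instance : Fintype Letter :=
  ⟨{Letter.a, Letter.b, Letter.sharp}, fun x => by cases x <;> simp⟩

/-- `a^{ℓ₁} # a^{ℓ₂} # ⋯ a^{ℓₘ} # b^n`, for the list `ls = [ℓ₁, …, ℓₘ]`. -/
def blockWord (ls : List ℕ) (n : ℕ) : List Letter :=
  ls.flatMap (fun l => List.replicate l Letter.a ++ [Letter.sharp]) ++ List.replicate n Letter.b

/-- The language `(a* #)* b^n` where `n` is the length of some `a`-block. -/
def Lblock : Language Letter :=
  {w | ∃ (ls : List ℕ) (n : ℕ), n ∈ ls ∧ w = blockWord ls n}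

/-!
With `n` tokens, token `i` ignores the first `i` blocks and counts the next one on its stack; a word
of length at most `n` has at most `n` blocks, so some token counts the right one.

Conversely, take `N` blocks of distinct large lengths and follow them by more and more letters `b`.
With fewer than `N` tokens, some token accepts twice: a single run accepts after `b^s`, where `s` is
the length of block `i`, and again after `t` further letters `b`. A pushdown automaton recognises
the words marked with the places of two such acceptances, and Ogden's lemma, with the letters of
block `i` marked, pumps its word so that block `i` grows. If the word is pumped often enough, the
only block that can still be as long as `b^s` is block `i`, as the lengths were distinct; so `b^s`
grows. Then `b^(s+t)` grows as well, and with it another block of that length. So block `i`, another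
block and `b^s` all grow, but pumping repeats only two factors, each inside a single segment.
-/

namespace PDA

section Runs

variable {Q A G : Type} {P : PDA Q A G}

theorem Run.trans {c d e : Conf Q G} {v w : List A} (h : P.Run c v d) (h' : P.Run d w e) :
    P.Run c (v ++ w) e := by
  induction h with
  | refl => exact h'
  | eps h _ ih => exact .eps h (ih h')
  | read h _ ih => exact .read h (ih h')

theorem Step.run {c d : Conf Q G} {o : Option A} (h : P.Step c o d) : P.Run c o.toList d :=
  match o, h with
  | none, h => .eps h (.refl d)
  | some _, h => .read h (.refl d)

theorem Step.run_append {c d e : Conf Q G} {o : Option A} {w : List A} (h : P.Step c o d)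
    (h' : P.Run d w e) : P.Run c (o.toList ++ w) e :=
  h.run.trans h'

theorem Step.append_stack {c d : Conf Q G} {o : Option A} (h : P.Step c o d) (β : List G) :
    P.Step (c.1, c.2 ++ β) o (d.1, d.2 ++ β) := by
  obtain ⟨h⟩ := h
  rw [List.append_assoc]
  exact .mk h

theorem Run.append_stack {c d : Conf Q G} {w : List A} (h : P.Run c w d) (β : List G) :
    P.Run (c.1, c.2 ++ β) w (d.1, d.2 ++ β) := by
  induction h with
  | refl => exact .refl _
  | eps h _ ih => exact .eps (h.append_stack β) ih
  | read h _ ih => exact .read (h.append_stack β) ih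

theorem TokenMove.run {c d : Conf Q G} {a : A} (h : P.TokenMove c a d) : P.Run c [a] d := by
  obtain ⟨c', hε, ha⟩ := h
  induction hε using Relation.ReflTransGen.head_induction_on with
  | refl => exact ha.run
  | head h _ ih => exact .eps h ih

theorem IsWinning.run {n k : ℕ} {σ : Strategy Q A G k} (h : P.IsWinning n σ) {u v : List A}
    (huv : (u ++ v).length ≤ n) (l : Fin k) : P.Run (σ u l) v (σ (u ++ v) l) := by
  induction v using List.reverseRecOn with
  | nil => simpa only [List.append_nil] using Run.refl (σ u l)
  | append_singleton v a ih =>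
    rw [← List.append_assoc] at huv ⊢
    rw [List.length_append, List.length_singleton] at huv
    exact (ih (by omega)).trans (h.move _ _ (by omega) l).run

end Runs

section Pops

variable {Q A G : Type} {P : PDA Q A G}

/-- `P.Pops q β w q'`: from state `q` the automaton can read `w` while emptying the stack `β`, and
end in state `q'`. The presentation by derivation forests keeps apart the part of the run that
pops the top symbol and the part that pops the remaining stack. -/
inductive Pops (P : PDA Q A G) : Q → List G → List A → Q → Prop
  | nil (q : Q) : Pops P q [] [] q
  | cons {q r s q' : Q} {o : Option A} {X : G} {γ β : List G} {v w : List A}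
      (h : (r, γ) ∈ P.δ q o X) (t : Pops P r γ v s) (t' : Pops P s β w q') :
      Pops P q (X :: β) (o.toList ++ v ++ w) q'

theorem Pops.append {q r q' : Q} {β β' : List G} {v w : List A} (h : P.Pops q β v r)
    (h' : P.Pops r β' w q') : P.Pops q (β ++ β') (v ++ w) q' := by
  induction h with
  | nil => exact h'
  | cons h t _ _ ih =>
    rw [List.append_assoc]
    exact .cons h t (ih h')

theorem Pops.exists_of_append {q q' : Q} {γ β : List G} {w : List A}
    (h : P.Pops q (γ ++ β) w q') :
    ∃ v u r, w = v ++ u ∧ P.Pops q γ v r ∧ P.Pops r β u q' := by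
  induction γ generalizing q w with
  | nil => exact ⟨[], w, q, rfl, .nil q, h⟩
  | cons X γ ih =>
    obtain _ | ⟨h, t, t'⟩ := h
    obtain ⟨v, u, r, rfl, hγ, hβ⟩ := ih t'
    exact ⟨_, u, r, (List.append_assoc ..).symm, .cons h t hγ, hβ⟩

theorem Step.pops {c d : Conf Q G} {o : Option A} {w : List A} {q' : Q} (h : P.Step c o d)
    (t : P.Pops d.1 d.2 w q') : P.Pops c.1 c.2 (o.toList ++ w) q' := by
  obtain ⟨h⟩ := h
  obtain ⟨v, u, r, rfl, hγ, hβ⟩ := t.exists_of_append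
  rw [← List.append_assoc]
  exact .cons h hγ hβ

theorem Run.pops {c d : Conf Q G} {w : List A} (h : P.Run c w d) (hd : d.2 = []) :
    P.Pops c.1 c.2 w d.1 := by
  induction h with
  | refl c => rw [hd]; exact .nil _
  | eps h _ ih => exact h.pops (ih hd)
  | read h _ ih => exact h.pops (ih hd)

theorem Pops.run {q q' : Q} {β : List G} {w : List A} (h : P.Pops q β w q') :
    P.Run (q, β) w (q', []) := by
  induction h with
  | nil q => exact .refl _
  | cons h _ _ ih ih' =>
    rw [List.append_assoc]
    exact Step.run_append (.mk h) ((ih.append_stack _).trans ih')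

end Pops

end PDA

/-- `(v, y)` is a context taking words of `T` to words of `S`. -/
def WrapsInto {A : Type} (T S : Language A) (v y : List A) : Prop :=
  ∀ x ∈ T, v ++ x ++ y ∈ S

/-- The word `w` of `S` can be pumped within `S`, and a letter marked by `p` is pumped: this is the
conclusion of Ogden's lemma, `T` playing the role of the language of the repeated nonterminal. -/
def HasPump {A : Type} (p : A → Bool) (S : Language A) (w : List A) : Prop :=
  ∃ (T : Language A) (v₁ v x y y₁ : List A), w = v₁ ++ (v ++ x ++ y) ++ y₁ ∧
    WrapsInto T S v₁ y₁ ∧ WrapsInto T T v y ∧ x ∈ T ∧ 0 < (v ++ y).countP p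

/-- The word `v₁ vⁿ x yⁿ y₁`. -/
def pumpedWord {A : Type} (v₁ v x y y₁ : List A) (n : ℕ) : List A :=
  v₁ ++ ((List.replicate n v).flatten ++ x ++ (List.replicate n y).flatten) ++ y₁

section Pumping

variable {A : Type} {p : A → Bool} {R S T : Language A} {v w x y v' y' : List A}

theorem WrapsInto.refl (S : Language A) : WrapsInto S S [] [] := fun x hx => by
  simpa only [List.nil_append, List.append_nil] using hx

theorem WrapsInto.comp (h : WrapsInto S R v y) (h' : WrapsInto T S v' y') :
    WrapsInto T R (v ++ v') (y' ++ y) := fun x hx => by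
  simpa only [List.append_assoc] using h _ (h' x hx)

theorem WrapsInto.iterate (h : WrapsInto T T v y) (n : ℕ) :
    WrapsInto T T (List.replicate n v).flatten (List.replicate n y).flatten := by
  induction n with
  | zero => exact .refl T
  | succ n ih =>
    rw [List.replicate_succ, List.flatten_cons, List.replicate_succ', List.flatten_append,
      List.flatten_singleton]
    exact h.comp ih

theorem HasPump.wrap (h : HasPump p T w) (hw : WrapsInto T S v y) :
    HasPump p S (v ++ w ++ y) := by
  obtain ⟨U, v₁, v₂, x, y₂, y₁, rfl, h₁, h₂, hx, hp⟩ := h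
  exact ⟨U, v ++ v₁, v₂, x, y₂, y₁ ++ y, by simp only [List.append_assoc], hw.comp h₁, h₂, hx, hp⟩

theorem HasPump.exists_pumpedWord (h : HasPump p S w) :
    ∃ v₁ v x y y₁ : List A, w = pumpedWord v₁ v x y y₁ 1 ∧ 0 < (v ++ y).countP p ∧
      ∀ n, pumpedWord v₁ v x y y₁ n ∈ S := by
  obtain ⟨T, v₁, v, x, y, y₁, rfl, h₁, h₂, hx, hp⟩ := h
  exact ⟨v₁, v, x, y, y₁, by simp [pumpedWord], hp, fun n => h₁ _ (h₂.iterate n x hx)⟩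

end Pumping

namespace PDA

section Ogden

variable {Q A G : Type} {P : PDA Q A G} {p : A → Bool} {R S T : Language A} {v w x y : List A}
  {b : Q × G × Q} {m n : ℕ}

/-- The words that `P` can read while emptying the stack `β` and passing from `q` to `q'`. -/
def popLanguage (P : PDA Q A G) (q : Q) (β : List G) (q' : Q) : Language A :=
  {w | P.Pops q β w q'}

/-- The language of the nonterminal `(q, X, q')` in the grammar given by the triple
construction. -/
def tripleLanguage (P : PDA Q A G) (b : Q × G × Q) : Language A :=
  P.popLanguage b.1 [b.2.1] b.2.2

/-- The word `w` of `S` has a derivation in which the nonterminal `b` derives the factor `x`. -/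
def Occurs (P : PDA Q A G) (S : Language A) (w : List A) (b : Q × G × Q) (x : List A) : Prop :=
  ∃ v y, w = v ++ x ++ y ∧ WrapsInto (P.tripleLanguage b) S v y ∧ x ∈ P.tripleLanguage b

/-- Either `w` can be pumped, or it is a concatenation of `m` words with few marked letters. The
bound is in terms of a set `K` of nonterminals with occurrences deriving few marked letters: when
such a nonterminal is met again above its occurrence, either marked letters were produced in
between, which gives a pump, or the bound is unchanged. -/
def PumpOrBound (P : PDA Q A G) (p : A → Bool) (S : Language A) (w : List A) (m : ℕ) : Prop :=
  HasPump p S w ∨ ∃ K : Finset (Q × G × Q), w.countP p ≤ m * 3 ^ K.card ∧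
    ∀ b ∈ K, ∃ x, x.countP p ≤ 3 ^ K.card ∧ P.Occurs S w b x

theorem Occurs.wrap (h : P.Occurs T w b x) (hw : WrapsInto T S v y) :
    P.Occurs S (v ++ w ++ y) b x := by
  obtain ⟨v₁, y₁, rfl, h₁, hx⟩ := h
  exact ⟨v ++ v₁, y₁ ++ y, by simp only [List.append_assoc], hw.comp h₁, hx⟩

theorem PumpOrBound.concat (hv : P.PumpOrBound p S v m) (hw : P.PumpOrBound p T w n)
    (hS : WrapsInto S R [] w) (hT : WrapsInto T R v []) : P.PumpOrBound p R (v ++ w) (m + n) := by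
  obtain hv | ⟨K, hK, hocc⟩ := hv
  · exact .inl (hv.wrap hS)
  obtain hw | ⟨K', hK', hocc'⟩ := hw
  · exact .inl (List.append_nil (v ++ w) ▸ hw.wrap hT)
  unfold PumpOrBound
  simp only [List.countP_append, add_mul]
  obtain hle | hle := le_total K.card K'.card
  · refine .inr ⟨K', add_le_add (hK.trans (by gcongr; norm_num)) hK', fun b hb => ?_⟩
    obtain ⟨x, hx, h⟩ := hocc' b hb
    exact ⟨x, hx, List.append_nil (v ++ w) ▸ h.wrap hT⟩
  · refine .inr ⟨K, add_le_add hK (hK'.trans (by gcongr; norm_num)), fun b hb => ?_⟩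
    obtain ⟨x, hx, h⟩ := hocc b hb
    exact ⟨x, hx, h.wrap hS⟩

theorem PumpOrBound.of_production (h : P.PumpOrBound p S w 2) (hw : w ∈ S) (hv : v.length ≤ 1)
    (hvS : WrapsInto S (P.tripleLanguage b) v []) :
    P.PumpOrBound p (P.tripleLanguage b) (v ++ w) 1 := by
  classical
  have wrapped {x} {b'} (h : P.Occurs S w b' x) : P.Occurs (P.tripleLanguage b) (v ++ w) b' x :=
    List.append_nil (v ++ w) ▸ h.wrap hvS
  obtain h | ⟨K, hK, hocc⟩ := h
  · exact .inl (List.append_nil (v ++ w) ▸ h.wrap hvS)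
  by_cases hb : b ∈ K
  · obtain ⟨x, hx, hbx⟩ := hocc b hb
    obtain ⟨v₁, y₁, hvw, h₁, hxb⟩ := wrapped hbx
    rcases Nat.eq_zero_or_pos ((v₁ ++ y₁).countP p) with h0 | hpos
    · refine .inr ⟨K, ?_, fun b' hb' => (hocc b' hb').imp fun x h => ⟨h.1, wrapped h.2⟩⟩
      simp only [hvw, List.countP_append] at h0 ⊢
      omega
    · exact .inl ⟨_, [], v₁, x, y₁, [], by simpa using hvw, .refl _, h₁, hxb, hpos⟩
  · have hcount : (v ++ w).countP p ≤ 3 ^ (insert b K).card := by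
      have := v.countP_le_length (p := p)
      have := Nat.one_le_pow K.card 3 (by norm_num)
      rw [Finset.card_insert_of_notMem hb, List.countP_append, pow_succ]
      omega
    refine .inr ⟨insert b K, by rwa [one_mul], Finset.forall_mem_insert .. |>.2 ⟨?_, ?_⟩⟩
    · exact ⟨v ++ w, hcount, [], [], by simp, .refl _,
        by simpa only [List.append_nil] using hvS w hw⟩
    · intro b' hb'
      obtain ⟨x, hx, h⟩ := hocc b' hb'
      exact ⟨x, hx.trans (Nat.pow_le_pow_right (by norm_num)
        (Finset.card_le_card (Finset.subset_insert b K))), wrapped h⟩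

theorem PumpOrBound.mono (h : P.PumpOrBound p S w m) (hmn : m ≤ n) : P.PumpOrBound p S w n :=
  h.imp id fun ⟨K, hK, hocc⟩ => ⟨K, hK.trans (by gcongr), hocc⟩

theorem Pops.mem_tripleLanguage {q r s : Q} {o : Option A} {X : G} {γ : List G} {v : List A}
    (h : (r, γ) ∈ P.δ q o X) (t : P.Pops r γ v s) : o.toList ++ v ∈ P.tripleLanguage (q, X, s) :=
  List.append_nil (o.toList ++ v) ▸ Pops.cons h t (.nil s)

theorem Pops.pumpOrBound (p : A → Bool) {q q' : Q} {β : List G} {w : List A}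
    (h : P.Pops q β w q') : P.PumpOrBound p (P.popLanguage q β q') w β.length := by
  induction h with
  | nil => exact .inr ⟨∅, by simp⟩
  | @cons q r s q' o X γ β v w h t t' ih ih' =>
    have htree : P.PumpOrBound p (P.tripleLanguage (q, X, s)) (o.toList ++ v) 1 :=
      (ih.mono (P.length_le_two _ _ _ _ _ h)).of_production t (by cases o <;> simp) fun x hx => by
        simpa only [List.append_nil] using Pops.mem_tripleLanguage h hx
    rw [List.length_cons, add_comm]
    refine htree.concat ih' (fun u hu => Pops.append hu t') fun z hz => ?_
    rw [List.append_nil]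
    exact Pops.append (Pops.mem_tripleLanguage h t) hz

theorem Pops.hasPump [Fintype Q] [Fintype G] {q q' : Q} {X : G} (h : P.Pops q [X] w q')
    (hw : 3 ^ Fintype.card (Q × G × Q) < w.countP p) : HasPump p (P.popLanguage q [X] q') w := by
  refine (h.pumpOrBound p).resolve_right fun ⟨K, hK, _⟩ => hw.not_ge ?_
  rw [List.length_singleton, one_mul] at hK
  exact hK.trans (Nat.pow_le_pow_right (by norm_num) K.card_le_univ)

end Ogden

section Emptying

variable {Q A G : Type} {P : PDA Q A G}

/-- The transitions of `P.emptying`. -/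
inductive EmptyingMove (P : PDA Q A G) : Option Q → Option A → G → Option Q → List G → Prop
  | simulate {q r : Q} {o : Option A} {X : G} {γ : List G} (h : (r, γ) ∈ P.δ q o X) :
      EmptyingMove P (some q) o X (some r) γ
  | leave {q : Q} (hq : q ∈ P.F) (X : G) : EmptyingMove P (some q) none X none []
  | drain (X : G) : EmptyingMove P none none X none []

/-- The automaton that simulates `P` and may leave an accepting state for the new state `none`, in
which it empties its stack. It turns acceptance by final state into acceptance by empty stack in a
final state; the accepting states of `P` stay final, as `P` may have emptied its own stack. -/
def emptying (P : PDA Q A G) : PDA (Option Q) A G where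
  δ q o X := {c | P.EmptyingMove q o X c.1 c.2}
  length_le_two := by
    rintro _ _ _ _ _ (h | _ | _)
    exacts [P.length_le_two _ _ _ _ _ h, by simp, by simp]
  q₀ := some P.q₀
  Z₀ := P.Z₀
  F := insert none (some '' P.F)

theorem Run.emptying {c d : Conf Q G} {w : List A} (h : P.Run c w d) :
    P.emptying.Run (some c.1, c.2) w (some d.1, d.2) := by
  induction h with
  | refl => exact .refl _
  | eps h _ ih =>
    obtain ⟨h⟩ := h
    exact .eps (.mk (.simulate h)) ih
  | read h _ ih =>
    obtain ⟨h⟩ := h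
    exact .read (.mk (.simulate h)) ih

theorem pops_emptying_none (β : List G) : P.emptying.Pops none β [] none := by
  induction β with
  | nil => exact .nil none
  | cons X β ih =>
    have hdrain : (none, []) ∈ P.emptying.δ none none X := .drain X
    exact .cons hdrain (.nil none) ih

theorem exists_pops_emptying {q : Q} (hq : q ∈ P.F) (β : List G) :
    ∃ r ∈ P.emptying.F, P.emptying.Pops (some q) β [] r := by
  cases β with
  | nil => exact ⟨some q, .inr ⟨q, hq, rfl⟩, .nil _⟩
  | cons X β =>
    have hleave : (none, []) ∈ P.emptying.δ (some q) none X := .leave hq X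
    exact ⟨none, .inl rfl, .cons hleave (.nil none) (pops_emptying_none β)⟩

theorem Run.eq_nil_of_emptying {c e : Conf (Option Q) G} {w : List A} (h : P.emptying.Run c w e)
    (hc : c.1 = none) : w = [] := by
  induction h with
  | refl => rfl
  | eps h _ ih =>
    obtain ⟨h⟩ := h
    cases hc
    cases h
    exact ih rfl
  | read h _ _ =>
    obtain ⟨h⟩ := h
    cases hc
    cases h

theorem Run.of_emptying {c e : Conf (Option Q) G} {w : List A} {q : Q}
    (h : P.emptying.Run c w e) (hc : c.1 = some q) (he : e.1 ∈ P.emptying.F) :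
    ∃ d, P.Run (q, c.2) w d ∧ d.1 ∈ P.F := by
  induction h generalizing q with
  | refl c =>
    obtain hnone | ⟨r, hr, hrc⟩ := he
    · simp [hnone] at hc
    · obtain rfl : r = q := Option.some_injective _ (hrc.trans hc)
      exact ⟨_, .refl _, hr⟩
  | eps h t ih =>
    obtain ⟨h⟩ := h
    cases hc
    rcases h with h | ⟨hq, X⟩ | _
    · exact (ih rfl he).imp fun d hd => ⟨.eps (.mk h) hd.1, hd.2⟩
    · rw [t.eq_nil_of_emptying rfl]
      exact ⟨_, .refl _, hq⟩
  | read h t ih =>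
    obtain ⟨h⟩ := h
    cases hc
    obtain h | _ | _ := h
    exact (ih rfl he).imp fun d hd => ⟨.read (.mk h) hd.1, hd.2⟩

theorem mem_language_iff_exists_pops {w : List A} :
    w ∈ P.language ↔ ∃ r ∈ P.emptying.F, P.emptying.Pops (some P.q₀) [P.Z₀] w r := by
  constructor
  · rintro ⟨d, hd, hF⟩
    obtain ⟨r, hr, h⟩ := exists_pops_emptying hF d.2
    have hrun : P.emptying.Run (some P.q₀, [P.Z₀]) (w ++ []) (r, []) := hd.emptying.trans h.run
    exact ⟨r, hr, List.append_nil w ▸ hrun.pops rfl⟩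
  · rintro ⟨r, hr, h⟩
    exact h.run.of_emptying rfl hr

/-- **Ogden's lemma** for pushdown automata, the marked positions being those of the letters in a
given set. -/
theorem exists_pumping_constant [Finite Q] [Finite G] (P : PDA Q A G) :
    ∃ K, ∀ w ∈ P.language, ∀ p : A → Bool, K < w.countP p →
      ∃ v₁ v x y y₁ : List A, w = pumpedWord v₁ v x y y₁ 1 ∧ 0 < (v ++ y).countP p ∧
        ∀ n, pumpedWord v₁ v x y y₁ n ∈ P.language := by
  have := Fintype.ofFinite Q
  have := Fintype.ofFinite G
  refine ⟨3 ^ Fintype.card (Option Q × G × Option Q), fun w hw p hp => ?_⟩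
  obtain ⟨r, hr, h⟩ := mem_language_iff_exists_pops.1 hw
  obtain ⟨v₁, v, x, y, y₁, hw, hpos, hpump⟩ := (h.hasPump hp).exists_pumpedWord
  exact ⟨v₁, v, x, y, y₁, hw, hpos, fun n => mem_language_iff_exists_pops.2 ⟨r, hr, hpump n⟩⟩

end Emptying

end PDA

section BlockWords

open Letter

variable {m : ℕ} {ls : List ℕ} {w : List Letter}

theorem blockWord_nil (m : ℕ) : blockWord [] m = List.replicate m b := rfl

theorem blockWord_zero_cons (ls : List ℕ) (m : ℕ) :
    blockWord (0 :: ls) m = sharp :: blockWord ls m := by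
  simp [blockWord]

theorem blockWord_succ_cons (l : ℕ) (ls : List ℕ) (m : ℕ) :
    blockWord ((l + 1) :: ls) m = a :: blockWord (l :: ls) m := by
  simp [blockWord, List.replicate_succ]

theorem blockWord_append_replicate (ls : List ℕ) (m k : ℕ) :
    blockWord ls m ++ List.replicate k b = blockWord ls (m + k) := by
  simp [blockWord]

theorem blockWord_eq_nil_iff : blockWord ls m = [] ↔ ls = [] ∧ m = 0 := by
  cases ls <;> simp [blockWord]

theorem a_cons_eq_blockWord_iff :
    a :: w = blockWord ls m ↔ ∃ l ls', ls = (l + 1) :: ls' ∧ w = blockWord (l :: ls') m := by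
  rcases ls with _ | ⟨_ | l, ls⟩
  · cases m <;> simp [blockWord_nil, List.replicate_succ]
  · simp [blockWord_zero_cons]
  · simp [blockWord_succ_cons]

theorem sharp_cons_eq_blockWord_iff :
    sharp :: w = blockWord ls m ↔ ∃ ls', ls = 0 :: ls' ∧ w = blockWord ls' m := by
  rcases ls with _ | ⟨_ | l, ls⟩
  · cases m <;> simp [blockWord_nil, List.replicate_succ]
  · simp [blockWord_zero_cons]
  · simp [blockWord_succ_cons]

theorem b_cons_eq_blockWord_iff :
    b :: w = blockWord ls m ↔ ls = [] ∧ ∃ m', m = m' + 1 ∧ w = blockWord [] m' := by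
  rcases ls with _ | ⟨_ | l, ls⟩
  · cases m <;> simp [blockWord_nil, List.replicate_succ]
  · simp [blockWord_zero_cons]
  · simp [blockWord_succ_cons]

theorem blockWord_inj {ls' : List ℕ} {m' : ℕ} :
    blockWord ls m = blockWord ls' m' ↔ ls = ls' ∧ m = m' := by
  refine ⟨fun h => ?_, by rintro ⟨rfl, rfl⟩; rfl⟩
  induction h' : blockWord ls m generalizing ls ls' m m' with
  | nil =>
    obtain ⟨rfl, rfl⟩ := blockWord_eq_nil_iff.1 h'
    obtain ⟨rfl, rfl⟩ := blockWord_eq_nil_iff.1 (h.symm.trans h')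
    simp
  | cons x w ih =>
    have h₁ := h'.symm
    have h₂ := h₁.trans h
    cases x
    · obtain ⟨l, ls, rfl, rfl⟩ := a_cons_eq_blockWord_iff.1 h₁
      obtain ⟨l', ls', rfl, hw⟩ := a_cons_eq_blockWord_iff.1 h₂
      simpa using ih hw rfl
    · obtain ⟨rfl, m, rfl, rfl⟩ := b_cons_eq_blockWord_iff.1 h₁
      obtain ⟨rfl, m', rfl, hw⟩ := b_cons_eq_blockWord_iff.1 h₂
      simpa [blockWord_nil] using hw
    · obtain ⟨ls, rfl, rfl⟩ := sharp_cons_eq_blockWord_iff.1 h₁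
      obtain ⟨ls', rfl, hw⟩ := sharp_cons_eq_blockWord_iff.1 h₂
      simpa using ih hw rfl

theorem blockWord_mem_Lblock_iff : blockWord ls m ∈ Lblock ↔ m ∈ ls := by
  refine ⟨?_, fun h => ⟨ls, m, h, rfl⟩⟩
  rintro ⟨ls', m', h, heq⟩
  obtain ⟨rfl, rfl⟩ := blockWord_inj.1 heq
  exact h

theorem length_le_length_blockWord (ls : List ℕ) (m : ℕ) :
    ls.length ≤ (blockWord ls m).length := by
  induction ls with
  | nil => simp
  | cons l ls ih =>
    simp only [blockWord, List.flatMap_cons, List.length_append, List.length_cons] at ih ⊢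
    omega

end BlockWords

section TallyWords

variable {N : ℕ} {fs : List ℕ}

/-- The word `j ⋯ j (j + 1) ⋯ (j + 1) ⋯` in which the letter `j + k` occurs `fs[k]` times. -/
def tallyWord : ℕ → List ℕ → List ℕ
  | _, [] => []
  | j, f :: fs => List.replicate f j ++ tallyWord (j + 1) fs

theorem tallyWord_zero_cons (j : ℕ) (fs : List ℕ) : tallyWord j (0 :: fs) = tallyWord (j + 1) fs :=
  rfl

theorem tallyWord_succ_cons (j f : ℕ) (fs : List ℕ) :
    tallyWord j ((f + 1) :: fs) = j :: tallyWord j (f :: fs) := rfl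

theorem le_of_mem_tallyWord {j x : ℕ} (h : x ∈ tallyWord j fs) : j ≤ x := by
  induction fs generalizing j with
  | nil => cases h
  | cons f fs ih =>
    obtain h | h := List.mem_append.1 h
    · exact (List.eq_of_mem_replicate h).ge
    · exact (j.le_succ).trans (ih h)

theorem pairwise_tallyWord (j : ℕ) (fs : List ℕ) : (tallyWord j fs).Pairwise (· ≤ ·) := by
  induction fs generalizing j with
  | nil => exact .nil
  | cons f fs ih =>
    refine List.pairwise_append.2 ⟨List.pairwise_replicate.2 (.inr le_rfl), ih (j + 1), ?_⟩
    intro x hx y hy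
    rw [List.eq_of_mem_replicate hx]
    exact (j.le_succ).trans (le_of_mem_tallyWord hy)

theorem count_tallyWord (j k : ℕ) (fs : List ℕ) :
    (tallyWord j fs).count (j + k) = fs[k]?.getD 0 := by
  induction fs generalizing j k with
  | nil => simp [tallyWord]
  | cons f fs ih =>
    rw [tallyWord, List.count_append, List.count_replicate]
    cases k with
    | zero =>
      have : j ∉ tallyWord (j + 1) fs := fun h => (le_of_mem_tallyWord h).not_gt j.lt_succ_self
      simp [List.count_eq_zero.2 this]
    | succ k =>
      simpa [add_right_comm, ← add_assoc, (show j ≠ j + k + 1 by omega)] using ih (j + 1) k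

/-- The sorted words over `0, …, N + 1` in which the multiplicities of `0, …, N - 1` contain that
of `N` and also the joint multiplicity of `N` and `N + 1`. With `0, …, N - 1` for the blocks, they
encode two successive acceptances on a word of `Lblock` that is prolonged by further letters `b`. -/
def twiceTally (N : ℕ) : Language ℕ :=
  {z | z.Pairwise (· ≤ ·) ∧ (∃ g < N, z.count N = z.count g) ∧
    ∃ g < N, z.count N + z.count (N + 1) = z.count g}

theorem count_tallyWord_of_lt {ls ls' : List ℕ} {k : ℕ} (hk : k < ls.length) :
    (tallyWord 0 (ls ++ ls')).count k = ls[k] := by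
  have := count_tallyWord 0 k (ls ++ ls')
  simpa [List.getElem?_append_left hk, hk] using this

theorem count_tallyWord_length (ls : List ℕ) (m t : ℕ) :
    (tallyWord 0 (ls ++ [m, t])).count ls.length = m := by
  have := count_tallyWord 0 ls.length (ls ++ [m, t])
  simpa using this

theorem count_tallyWord_length_succ (ls : List ℕ) (m t : ℕ) :
    (tallyWord 0 (ls ++ [m, t])).count (ls.length + 1) = t := by
  have := count_tallyWord 0 (ls.length + 1) (ls ++ [m, t])
  simpa using this

theorem tallyWord_mem_twiceTally {ls : List ℕ} {m t : ℕ} (hm : m ∈ ls) (hmt : m + t ∈ ls) :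
    tallyWord 0 (ls ++ [m, t]) ∈ twiceTally ls.length := by
  obtain ⟨g, hg, hgm⟩ := List.mem_iff_getElem.1 hm
  obtain ⟨g', hg', hgmt⟩ := List.mem_iff_getElem.1 hmt
  refine ⟨pairwise_tallyWord _ _, ⟨g, hg, ?_⟩, g', hg', ?_⟩
  · rw [count_tallyWord_length, count_tallyWord_of_lt hg, hgm]
  · rw [count_tallyWord_length, count_tallyWord_length_succ, count_tallyWord_of_lt hg', hgmt]

theorem eq_of_pairwise_le_append_self {v : List ℕ} (h : (v ++ v).Pairwise (· ≤ ·)) {x y : ℕ}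
    (hx : x ∈ v) (hy : y ∈ v) : x = y :=
  have hle := (List.pairwise_append.1 h).2.2
  le_antisymm (hle x hx y hy) (hle y hy x hx)

section Pumped

variable {v₁ v x y y₁ : List ℕ} {i j k : ℕ}

theorem count_pumpedWord_succ (v₁ v x y y₁ : List ℕ) (n g : ℕ) :
    (pumpedWord v₁ v x y y₁ (n + 1)).count g =
      (pumpedWord v₁ v x y y₁ 1).count g + n * (v ++ y).count g := by
  simp only [pumpedWord, List.count_append, List.count_flatten, List.map_replicate,
    List.sum_replicate, smul_eq_mul]
  ring

theorem eq_or_eq_or_eq_of_pairwise_pumpedWord (h : (pumpedWord v₁ v x y y₁ 2).Pairwise (· ≤ ·))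
    (hi : i ∈ v ++ y) (hj : j ∈ v ++ y) (hk : k ∈ v ++ y) : i = j ∨ i = k ∨ j = k := by
  have hv : v ++ v <:+: pumpedWord v₁ v x y y₁ 2 :=
    ⟨v₁, x ++ (y ++ y) ++ y₁, by simp [pumpedWord, List.replicate_succ]⟩
  have hy : y ++ y <:+: pumpedWord v₁ v x y y₁ 2 :=
    ⟨v₁ ++ (v ++ v ++ x), y₁, by simp [pumpedWord, List.replicate_succ]⟩
  have eq_of_mem_v := @eq_of_pairwise_le_append_self _ (h.sublist hv.sublist)
  have eq_of_mem_y := @eq_of_pairwise_le_append_self _ (h.sublist hy.sublist)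
  simp only [List.mem_append] at hi hj hk
  tauto

theorem eq_and_eq_of_add_mul_eq_add_mul {c c' e e' n : ℕ} (hc : c < n) (hc' : c' < n)
    (h : c + n * e = c' + n * e') : c = c' ∧ e = e' := by
  obtain ⟨hdiv, hmod⟩ := (Nat.div_mod_unique (by omega)).2 ⟨h, hc⟩
  obtain ⟨hdiv', hmod'⟩ := (Nat.div_mod_unique (by omega)).2 ⟨Eq.refl (c' + n * e'), hc'⟩
  exact ⟨hmod.symm.trans hmod', hdiv.symm.trans hdiv'⟩

theorem mem_and_exists_mem_of_pumpedWord_mem_twiceTally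
    (hinj : Set.InjOn (pumpedWord v₁ v x y y₁ 1).count (Set.Iio N)) (hi : i < N)
    (hNi : (pumpedWord v₁ v x y y₁ 1).count N = (pumpedWord v₁ v x y y₁ 1).count i)
    (hN : 0 < (pumpedWord v₁ v x y y₁ 1).count (N + 1)) (hmem : i ∈ v ++ y)
    (h : ∀ n, pumpedWord v₁ v x y y₁ n ∈ twiceTally N) :
    N ∈ v ++ y ∧ ∃ g < N, g ≠ i ∧ g ∈ v ++ y := by
  have hle g : (pumpedWord v₁ v x y y₁ 1).count g ≤ (pumpedWord v₁ v x y y₁ 1).length :=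
    List.count_le_length
  obtain ⟨-, ⟨g, hg, h₁⟩, g', hg', h₂⟩ := h (2 * (pumpedWord v₁ v x y y₁ 1).length + 1 + 1)
  rw [count_pumpedWord_succ, count_pumpedWord_succ _ _ _ _ _ _ g] at h₁
  rw [count_pumpedWord_succ, count_pumpedWord_succ _ _ _ _ _ _ (N + 1),
    count_pumpedWord_succ _ _ _ _ _ _ g', add_add_add_comm, ← mul_add] at h₂
  have hbound g : (pumpedWord v₁ v x y y₁ 1).count g <
      2 * (pumpedWord v₁ v x y y₁ 1).length + 1 := by linarith [hle g]
  obtain ⟨hcg, heg⟩ := eq_and_eq_of_add_mul_eq_add_mul (hbound N) (hbound g) h₁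
  obtain ⟨hcg', heg'⟩ := eq_and_eq_of_add_mul_eq_add_mul
    (by linarith [hle N, hle (N + 1)]) (hbound g') h₂
  obtain rfl : g = i := hinj hg hi (hcg.symm.trans hNi)
  have hNmem : 0 < (v ++ y).count N := heg ▸ List.count_pos_iff.2 hmem
  refine ⟨List.count_pos_iff.1 hNmem, g', hg', ?_, List.count_pos_iff.1 (by omega)⟩
  rintro rfl
  omega

theorem not_forall_pumpedWord_mem_twiceTally
    (hinj : Set.InjOn (pumpedWord v₁ v x y y₁ 1).count (Set.Iio N)) (hi : i < N)
    (hNi : (pumpedWord v₁ v x y y₁ 1).count N = (pumpedWord v₁ v x y y₁ 1).count i)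
    (hN : 0 < (pumpedWord v₁ v x y y₁ 1).count (N + 1)) (hmem : i ∈ v ++ y) :
    ¬ ∀ n, pumpedWord v₁ v x y y₁ n ∈ twiceTally N := fun h => by
  obtain ⟨hNmem, g, hg, hgi, hgmem⟩ :=
    mem_and_exists_mem_of_pumpedWord_mem_twiceTally hinj hi hNi hN hmem h
  have := eq_or_eq_or_eq_of_pairwise_pumpedWord (h 2).1 hmem hgmem hNmem
  omega

end Pumped

end TallyWords

namespace PDA

section TallyPDA

variable {Q G : Type} {P : PDA Q Letter G} {N : ℕ}

/-- Some run from `c` is in an accepting state after `v`, and again after `v ++ w`. -/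
def AcceptsTwice {A : Type} (P : PDA Q A G) (c : Conf Q G) (v w : List A) : Prop :=
  ∃ d e, P.Run c v d ∧ d.1 ∈ P.F ∧ P.Run d w e ∧ e.1 ∈ P.F

/-- The transitions of `P.tallyPDA N`. -/
inductive TallyMove (P : PDA Q Letter G) (N : ℕ) :
    Q × Fin (N + 2) → Option ℕ → G → Q × Fin (N + 2) → List G → Prop
  | silent {q r : Q} {j : Fin (N + 2)} {X : G} {γ : List G} (h : (r, γ) ∈ P.δ q none X) :
      TallyMove P N (q, j) none X (r, j) γ
  | a {q r : Q} {j : Fin (N + 2)} {X : G} {γ : List G} (hj : (j : ℕ) < N)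
      (h : (r, γ) ∈ P.δ q (some .a) X) : TallyMove P N (q, j) (some (j : ℕ)) X (r, j) γ
  | b {q r : Q} {j : Fin (N + 2)} {X : G} {γ : List G} (hj : N ≤ (j : ℕ))
      (h : (r, γ) ∈ P.δ q (some .b) X) : TallyMove P N (q, j) (some (j : ℕ)) X (r, j) γ
  | sharp {q r : Q} {j j' : Fin (N + 2)} {X : G} {γ : List G} (hj : (j : ℕ) < N)
      (hj' : (j' : ℕ) = j + 1) (h : (r, γ) ∈ P.δ q (some .sharp) X) :
      TallyMove P N (q, j) none X (r, j') γ
  | check {q : Q} {j j' : Fin (N + 2)} (hj : (j : ℕ) = N) (hj' : (j' : ℕ) = j + 1) (hq : q ∈ P.F)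
      (X : G) : TallyMove P N (q, j) none X (q, j') [X]

/-- The automaton that guesses a word `blockWord ls m`, with `ls` of length `N`, and a prolongation
`b ⋯ b`, and checks that `P` accepts twice. The second component of its state is the current
phase: the phases below `N` are those of the blocks, and the phases `N` and `N + 1` are those of
the letters `b` before and after the first acceptance. Each letter `a` or `b` of the guessed word
is read as the number of the phase in which it occurs. -/
def tallyPDA (P : PDA Q Letter G) (N : ℕ) : PDA (Q × Fin (N + 2)) ℕ G where
  δ q o X := {c | P.TallyMove N q o X c.1 c.2}
  length_le_two := by
    rintro _ _ _ _ _ (h | ⟨_, h⟩ | ⟨_, h⟩ | ⟨_, _, h⟩ | _)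
    iterate 4 exact P.length_le_two _ _ _ _ _ h
    simp
  q₀ := (P.q₀, 0)
  Z₀ := P.Z₀
  F := {q | q.1 ∈ P.F ∧ (q.2 : ℕ) = N + 1}

theorem Step.acceptsTwice {c c' : Conf Q G} {o : Option Letter} {v w : List Letter}
    (h : P.Step c o c') (h' : P.AcceptsTwice c' v w) : P.AcceptsTwice c (o.toList ++ v) w := by
  obtain ⟨d, e, hd, h'⟩ := h'
  exact ⟨d, e, h.run_append hd, h'⟩

theorem Run.of_tallyPDA_of_last {c e : Conf (Q × Fin (N + 2)) G} {z : List ℕ}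
    (h : (P.tallyPDA N).Run c z e) (hc : (c.1.2 : ℕ) = N + 1) :
    ∃ t, z = List.replicate t (N + 1) ∧
      P.Run (c.1.1, c.2) (List.replicate t .b) (e.1.1, e.2) := by
  induction h with
  | refl => exact ⟨0, rfl, .refl _⟩
  | eps h _ ih =>
    obtain ⟨h⟩ := h
    rcases h with h | _ | _ | ⟨hj, _⟩ | ⟨hj, _⟩
    · obtain ⟨t, rfl, ht⟩ := ih hc
      exact ⟨t, rfl, .eps (.mk h) ht⟩
    all_goals
      dsimp only at hc
      omega
  | read h _ ih =>
    obtain ⟨h⟩ := h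
    rcases h with _ | ⟨hj, _⟩ | ⟨_, h⟩
    · dsimp only at hc
      omega
    · obtain ⟨t, rfl, ht⟩ := ih hc
      exact ⟨t + 1, by rw [hc]; rfl, .read (.mk h) ht⟩

theorem Run.of_tallyPDA {c e : Conf (Q × Fin (N + 2)) G} {z : List ℕ}
    (h : (P.tallyPDA N).Run c z e) (hc : (c.1.2 : ℕ) ≤ N) (he : e.1 ∈ (P.tallyPDA N).F) :
    ∃ ls m t, ls.length + c.1.2 = N ∧ z = tallyWord c.1.2 (ls ++ [m, t]) ∧
      P.AcceptsTwice (c.1.1, c.2) (blockWord ls m) (List.replicate t .b) := by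
  induction h with
  | refl =>
    have := he.2
    omega
  | eps h hrun ih =>
    obtain ⟨h⟩ := h
    rcases h with h | _ | _ | ⟨hj, hj', h⟩ | ⟨hj, hj', hq, _⟩
    · obtain ⟨ls, m, t, hlen, rfl, hacc⟩ := ih hc he
      exact ⟨ls, m, t, hlen, rfl, Step.acceptsTwice (.mk h) hacc⟩
    · obtain ⟨ls, m, t, hlen, rfl, hacc⟩ := ih (by dsimp only; omega) he
      refine ⟨0 :: ls, m, t, ?_, ?_, ?_⟩
      · simp only [List.length_cons] at hlen ⊢
        omega
      · rw [List.cons_append, tallyWord_zero_cons, ← hj']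
      · rw [blockWord_zero_cons]
        exact Step.acceptsTwice (.mk h) hacc
    · obtain ⟨t, rfl, ht⟩ := hrun.of_tallyPDA_of_last (by dsimp only; omega)
      refine ⟨[], 0, t, by simpa using hj, ?_, _, _, .refl _, hq, ht, he.1⟩
      simp [tallyWord, hj]
  | read h _ ih =>
    obtain ⟨h⟩ := h
    rcases h with _ | ⟨hj, h⟩ | ⟨hj, h⟩
    · obtain ⟨ls, m, t, hlen, rfl, hacc⟩ := ih hc he
      obtain _ | ⟨l, ls⟩ := ls
      · simp only [List.length_nil] at hlen
        omega
      · refine ⟨(l + 1) :: ls, m, t, hlen, (tallyWord_succ_cons ..).symm, ?_⟩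
        rw [blockWord_succ_cons]
        exact Step.acceptsTwice (.mk h) hacc
    · obtain ⟨ls, m, t, hlen, rfl, hacc⟩ := ih hc he
      obtain rfl : ls = [] := List.length_eq_zero_iff.1 (by dsimp only at hlen; omega)
      exact ⟨[], m + 1, t, hlen, (tallyWord_succ_cons ..).symm, Step.acceptsTwice (.mk h) hacc⟩

theorem Run.tallyPDA_of_last {d e : Conf Q G} {w : List Letter} {t : ℕ} {j : Fin (N + 2)}
    (h : P.Run d w e) (hj : (j : ℕ) = N + 1) (hw : w = List.replicate t .b) :
    (P.tallyPDA N).Run ((d.1, j), d.2) (List.replicate t (j : ℕ)) ((e.1, j), e.2) := by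
  induction h generalizing t with
  | refl =>
    obtain rfl : t = 0 := by simpa using hw.symm
    exact .refl _
  | eps h _ ih =>
    obtain ⟨h⟩ := h
    exact .eps (.mk (.silent h)) (ih hw)
  | read h _ ih =>
    obtain ⟨h⟩ := h
    obtain _ | t := t
    · cases hw
    · obtain ⟨rfl, rfl⟩ := List.cons.inj hw
      exact .read (.mk (.b (by omega) h)) (ih rfl)

theorem Run.snd_ne_nil {A : Type} {P : PDA Q A G} {c d : Conf Q G} {w : List A}
    (h : P.Run c w d) (hw : w ≠ []) : c.2 ≠ [] := by
  rcases h with _ | ⟨⟨_⟩, _⟩ | ⟨⟨_⟩, _⟩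
  · exact absurd rfl hw
  all_goals simp

theorem Run.exists_run_tallyPDA_of_check {d e : Conf Q G} {t : ℕ} {j : Fin (N + 2)}
    (h : P.Run d (List.replicate (t + 1) .b) e) (hj : (j : ℕ) = N) (hd : d.1 ∈ P.F)
    (he : e.1 ∈ P.F) : ∃ f, (P.tallyPDA N).Run ((d.1, j), d.2) (tallyWord j [0, t + 1]) f ∧
      f.1 ∈ (P.tallyPDA N).F := by
  obtain ⟨X, β, hβ⟩ := List.exists_cons_of_ne_nil (h.snd_ne_nil (by simp))
  have hcheck : (P.tallyPDA N).Step ((d.1, j), d.2) none ((d.1, Fin.last (N + 1)), d.2) := by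
    rw [hβ]
    exact .mk (γ := [X]) (.check hj (by simp [hj]) hd X)
  refine ⟨((e.1, Fin.last (N + 1)), e.2), .eps hcheck ?_, he, rfl⟩
  simpa [tallyWord, hj] using h.tallyPDA_of_last (j := Fin.last (N + 1)) rfl rfl

theorem Run.exists_run_tallyPDA {c d e : Conf Q G} {u : List Letter} {ls : List ℕ} {m t : ℕ}
    {j : Fin (N + 2)} (h : P.Run c u d) (hu : u = blockWord ls m) (hj : ls.length + (j : ℕ) = N)
    (hd : d.1 ∈ P.F) (hde : P.Run d (List.replicate (t + 1) .b) e) (he : e.1 ∈ P.F) :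
    ∃ f, (P.tallyPDA N).Run ((c.1, j), c.2) (tallyWord j (ls ++ [m, t + 1])) f ∧
      f.1 ∈ (P.tallyPDA N).F := by
  induction h generalizing j ls m with
  | refl =>
    obtain ⟨rfl, rfl⟩ := blockWord_eq_nil_iff.1 hu.symm
    exact hde.exists_run_tallyPDA_of_check (by simpa using hj) hd he
  | eps h _ ih =>
    obtain ⟨h⟩ := h
    obtain ⟨f, hf, hfF⟩ := ih hu hj hd hde
    exact ⟨f, .eps (.mk (.silent h)) hf, hfF⟩
  | @read _ _ _ x _ h _ ih =>
    obtain ⟨h⟩ := h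
    cases x
    · obtain ⟨l, ls, rfl, rfl⟩ := a_cons_eq_blockWord_iff.1 hu
      obtain ⟨f, hf, hfF⟩ := ih rfl hj hd hde
      rw [List.length_cons] at hj
      exact ⟨f, .read (.mk (.a (by omega) h)) hf, hfF⟩
    · obtain ⟨rfl, m, rfl, rfl⟩ := b_cons_eq_blockWord_iff.1 hu
      obtain ⟨f, hf, hfF⟩ := ih rfl hj hd hde
      rw [List.length_nil] at hj
      exact ⟨f, .read (.mk (.b (by omega) h)) hf, hfF⟩
    · obtain ⟨ls, rfl, rfl⟩ := sharp_cons_eq_blockWord_iff.1 hu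
      rw [List.length_cons] at hj
      have hj' : (j : ℕ) + 1 < N + 2 := by omega
      obtain ⟨f, hf, hfF⟩ := ih (j := ⟨j + 1, hj'⟩) rfl (by dsimp only; omega) hd hde
      exact ⟨f, .eps (.mk (.sharp (by omega) rfl h)) hf, hfF⟩

theorem AcceptsTwice.tallyWord_mem_language {ls : List ℕ} {m t : ℕ}
    (h : P.AcceptsTwice P.init (blockWord ls m) (List.replicate t .b)) (ht : 0 < t) :
    tallyWord 0 (ls ++ [m, t]) ∈ (P.tallyPDA ls.length).language := by
  obtain ⟨t, rfl⟩ := Nat.exists_eq_succ_of_ne_zero ht.ne'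
  obtain ⟨d, e, hd, hdF, he, heF⟩ := h
  exact hd.exists_run_tallyPDA (j := 0) rfl rfl hdF he heF

theorem AcceptsTwice.mem_language {A : Type} {P : PDA Q A G} {v w : List A}
    (h : P.AcceptsTwice P.init v w) : v ∈ P.language ∧ v ++ w ∈ P.language := by
  obtain ⟨d, e, hd, hdF, he, heF⟩ := h
  exact ⟨⟨d, hd, hdF⟩, e, hd.trans he, heF⟩

theorem language_tallyPDA_le_twiceTally (hP : P.language = Lblock) (N : ℕ) :
    (P.tallyPDA N).language ≤ twiceTally N := by
  rintro z ⟨e, hz, he⟩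
  obtain ⟨ls, m, t, hlen, rfl, hacc⟩ := hz.of_tallyPDA (Nat.zero_le N) he
  have hmem := hacc.mem_language
  rw [hP, blockWord_append_replicate, blockWord_mem_Lblock_iff, blockWord_mem_Lblock_iff] at hmem
  rw [← show ls.length = N from hlen]
  exact tallyWord_mem_twiceTally hmem.1 hmem.2

theorem exists_not_acceptsTwice [Finite Q] [Finite G] (hP : P.language = Lblock) (N : ℕ) :
    ∃ K, ∀ ls : List ℕ, ls.length = N → ls.Nodup → ∀ l ∈ ls, K < l → ∀ t, 0 < t →
      ¬ P.AcceptsTwice P.init (blockWord ls l) (List.replicate t .b) := by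
  obtain ⟨K, hK⟩ := (P.tallyPDA N).exists_pumping_constant
  refine ⟨K, ?_⟩
  rintro ls rfl hls l hl hKl t ht hacc
  obtain ⟨i, hi, rfl⟩ := List.mem_iff_getElem.1 hl
  obtain ⟨v₁, v, x, y, y₁, hw, hpos, hpump⟩ :=
    hK _ (hacc.tallyWord_mem_language ht) (· == i) (by rwa [← count_tallyWord_of_lt hi] at hKl)
  refine not_forall_pumpedWord_mem_twiceTally ?_ hi ?_ ?_
    (List.count_pos_iff.1 hpos) fun n => language_tallyPDA_le_twiceTally hP _ (hpump n)
  all_goals rw [← hw]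
  · intro g hg g' hg' h
    dsimp only at h
    rw [count_tallyWord_of_lt hg, count_tallyWord_of_lt hg'] at h
    exact (hls.getElem_inj_iff).1 h
  · rw [count_tallyWord_length, count_tallyWord_of_lt hi]
  · rwa [count_tallyWord_length_succ]

end TallyPDA

section LowerBound

variable {Q G : Type} {P : PDA Q Letter G}

theorem IsWinning.acceptsTwice {A : Type} {P : PDA Q A G} {n k : ℕ} {σ : Strategy Q A G k}
    (h : P.IsWinning n σ) {u v : List A} (huv : (u ++ v).length ≤ n) {l : Fin k}
    (hu : (σ u l).1 ∈ P.F) (hv : (σ (u ++ v) l).1 ∈ P.F) : P.AcceptsTwice P.init u v := by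
  have hrun : P.Run (σ [] l) u (σ u l) :=
    h.run (u := []) ((List.sublist_append_left u v).length_le.trans huv) l
  rw [h.start] at hrun
  exact ⟨_, _, hrun, hu, h.run huv l, hv⟩

theorem exists_le_of_isWinning [Finite Q] [Finite G] (hP : P.language = Lblock) (N : ℕ) :
    ∃ n₀, ∀ n ≥ n₀, ∀ (k : ℕ) (σ : Strategy Q Letter G k), P.IsWinning n σ → N ≤ k := by
  obtain ⟨K, hK⟩ := exists_not_acceptsTwice hP N
  let ls := List.range' (K + 1) N
  refine ⟨(blockWord ls (K + N)).length, fun n hn k σ hσ => ?_⟩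
  have hlen {m} (hm : m ≤ K + N) : (blockWord ls m).length ≤ n :=
    le_trans (by simpa [blockWord] using hm) hn
  have hmem (i : Fin N) : K + 1 + i ∈ ls := List.mem_range'_1.2 (by omega)
  have hwin (i : Fin N) : ∃ l, (σ (blockWord ls (K + 1 + i)) l).1 ∈ P.F :=
    hσ.win _ (hlen (by omega)) (hP ▸ blockWord_mem_Lblock_iff.2 (hmem i))
  choose τ hτ using hwin
  have hτ_inj : Function.Injective τ := .of_lt_imp_ne fun i j hij h => by
    obtain ⟨t, ht⟩ := Nat.exists_eq_add_of_lt hij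
    have hj : blockWord ls (K + 1 + i) ++ List.replicate (t + 1) .b = blockWord ls (K + 1 + j) := by
      rw [blockWord_append_replicate, ht, add_assoc (K + 1), add_assoc (i : ℕ)]
    exact hK ls List.length_range' List.nodup_range' _ (hmem i) (by omega) _ t.succ_pos
      (hσ.acceptsTwice (hj ▸ hlen (by omega)) (hτ i) (by rw [hj, h]; exact hτ j))
  simpa using Fintype.card_le_of_injective τ hτ_inj

theorem tendsto_atTop_of_isExplorable [Finite Q] [Finite G] (hP : P.language = Lblock) {f : ℕ → ℕ}
    (hf : P.IsExplorable f) : Filter.Tendsto f Filter.atTop Filter.atTop := by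
  refine Filter.tendsto_atTop.2 fun N => ?_
  obtain ⟨n₀, h⟩ := exists_le_of_isWinning hP N
  filter_upwards [Filter.eventually_ge_atTop n₀] with n hn
  obtain ⟨σ, hσ⟩ := hf n
  exact h n hn _ σ hσ

end LowerBound

end PDA

/-- The phases of the automaton for `Lblock`: a number of blocks is skipped, the next block is
counted on the stack, further blocks are passed over while waiting for the letters `b`, and these
pop the counter. The flag tells whether the automaton is inside a block. -/
inductive Phase : Type
  | skip (inBlock : Bool)
  | count
  | wait (inBlock : Bool)
  | pop
  | dead
  deriving Fintype

/-- The deterministic transitions of the automaton for `Lblock` reading a letter. The second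
component of a state tells whether the counter is zero. The stack symbol `none` marks the bottom;
the symbol `some z` stands for one unit of the counter and records that component before the unit
was added, which restores it when the unit is removed. -/
def blockMove : Phase × Bool → Letter → Option Bool → (Phase × Bool) × List (Option Bool)
  | (.skip _, z), .a, X => ((.skip true, z), [X])
  | (.skip _, z), .sharp, X => ((.skip false, z), [X])
  | (.count, z), .a, X => ((.count, false), [some z, X])
  | (.count, z), .sharp, X => ((.wait false, z), [X])
  | (.wait _, z), .a, X => ((.wait true, z), [X])
  | (.wait _, z), .sharp, X => ((.wait false, z), [X])
  | (.wait false, _), .b, some z => ((.pop, z), [])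
  | (.pop, _), .b, some z => ((.pop, z), [])
  | (_, z), _, X => ((.dead, z), [X])

/-- An automaton for `Lblock`, whose only choice is the block to be counted. -/
def blockPDA : PDA (Phase × Bool) Letter (Option Bool) where
  δ
    | q, none, X => {c | q.1 = .skip false ∧ c = ((.count, q.2), [X])}
    | q, some x, X => {blockMove q x X}
  length_le_two := by
    rintro q (_ | x) X q' γ h
    · have hγ : γ = [X] := congrArg Prod.snd h.2
      simp [hγ]
    · have hγ : γ = (blockMove q x X).2 := congrArg Prod.snd h
      rw [hγ]
      unfold blockMove
      split <;> simp
  q₀ := (.skip false, true)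
  Z₀ := none
  F := {(.wait false, true), (.pop, true)}

section BlockPDA

variable {c c' c'' : PDA.Conf (Phase × Bool) (Option Bool)} {x : Letter}

theorem blockPDA_step_letter (q : Phase × Bool) (x : Letter) (X : Option Bool)
    (β : List (Option Bool)) :
    blockPDA.Step (q, X :: β) (some x) ((blockMove q x X).1, (blockMove q x X).2 ++ β) :=
  .mk rfl

theorem blockPDA_step_letter_unique (h : blockPDA.Step c (some x) c')
    (h' : blockPDA.Step c (some x) c'') : c' = c'' := by
  obtain ⟨h⟩ := h
  obtain ⟨h'⟩ := h'
  obtain ⟨rfl, rfl⟩ := Prod.mk.inj (h.trans h'.symm)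
  rfl

theorem of_blockPDA_step_none (h : blockPDA.Step c none c') :
    c.1.1 = .skip false ∧ c' = ((.count, c.1.2), c.2) := by
  obtain ⟨hq, h⟩ := h
  obtain ⟨rfl, rfl⟩ := Prod.mk.inj h
  exact ⟨hq, rfl⟩

end BlockPDA

/-- The stack of `blockPDA` when the counter is `r`. -/
def counterStack : ℕ → List (Option Bool)
  | 0 => [none]
  | r + 1 => some (r == 0) :: counterStack r

/-- The state of a token that has been assigned a block: it has `k` blocks to skip before it
counts one (not including the current one, if it is inside a block), or its counter is `r`. -/
inductive Tracker : Type
  | skip (k : ℕ) (inBlock : Bool)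
  | count (r : ℕ)
  | wait (inBlock : Bool) (r : ℕ)
  | pop (r : ℕ)
  | dead (r : ℕ)

namespace Tracker

variable {d : Tracker} {x : Letter} {w : List Letter}

/-- The configuration of a token. -/
def conf : Tracker → PDA.Conf (Phase × Bool) (Option Bool)
  | skip _ inBlock => ((.skip inBlock, true), counterStack 0)
  | count r => ((.count, r == 0), counterStack r)
  | wait inBlock r => ((.wait inBlock, r == 0), counterStack r)
  | pop r => ((.pop, r == 0), counterStack r)
  | dead r => ((.dead, r == 0), counterStack r)

/-- The move of a token in a round. A token about to count starts doing so with the first letter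
of its block. -/
def next : Tracker → Letter → Tracker
  | skip 0 false, .a => count 1
  | skip 0 false, .sharp => wait false 0
  | skip (k + 1) false, .a => skip k true
  | skip (k + 1) false, .sharp => skip k false
  | skip k true, .a => skip k true
  | skip k true, .sharp => skip k false
  | skip _ _, .b => dead 0
  | count r, .a => count (r + 1)
  | count r, .sharp => wait false r
  | wait _ r, .a => wait true r
  | wait _ r, .sharp => wait false r
  | wait false (r + 1), .b => pop r
  | pop (r + 1), .b => pop r
  | count r, .b => dead r
  | wait _ r, .b => dead r
  | pop r, _ => dead r
  | dead r, _ => dead r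

/-- The words after which the token is in an accepting state. -/
def residual : Tracker → Set (List Letter)
  | skip k false => {w | ∃ ls m, w = blockWord ls m ∧ ls[k]? = some m}
  | skip k true => {w | ∃ l ls m, w = blockWord (l :: ls) m ∧ ls[k]? = some m}
  | count r => {w | ∃ l ls, w = blockWord (l :: ls) (r + l)}
  | wait false r => {w | ∃ ls, w = blockWord ls r}
  | wait true r => {w | ∃ l ls, w = blockWord (l :: ls) r}
  | pop r => {blockWord [] r}
  | dead _ => ∅

theorem nil_mem_residual_iff : [] ∈ d.residual ↔ d.conf.1 ∈ blockPDA.F := by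
  rcases d with ⟨k, _ | _⟩ | r | ⟨_ | _, r⟩ | r | r
  all_goals simp [residual, conf, blockPDA, blockWord_eq_nil_iff]

theorem a_cons_mem_residual_iff : .a :: w ∈ d.residual ↔ w ∈ (d.next .a).residual := by
  rcases d with ⟨_ | k, _ | _⟩ | r | ⟨_ | _, r⟩ | r | r
  all_goals simp [residual, next, a_cons_eq_blockWord_iff] <;> grind

theorem sharp_cons_mem_residual_iff :
    .sharp :: w ∈ d.residual ↔ w ∈ (d.next .sharp).residual := by
  rcases d with ⟨_ | k, _ | _⟩ | r | ⟨_ | _, r⟩ | r | r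
  all_goals simp [residual, next, sharp_cons_eq_blockWord_iff] <;> grind

theorem b_cons_mem_residual_iff : .b :: w ∈ d.residual ↔ w ∈ (d.next .b).residual := by
  rcases d with ⟨_ | k, _ | _⟩ | r | ⟨_ | _, _ | r⟩ | (_ | r) | r
  all_goals simp [residual, next, b_cons_eq_blockWord_iff]

theorem cons_mem_residual_iff : x :: w ∈ d.residual ↔ w ∈ (d.next x).residual := by
  cases x
  exacts [a_cons_mem_residual_iff, b_cons_mem_residual_iff, sharp_cons_mem_residual_iff]

theorem mem_residual_iff : w ∈ d.residual ↔ (w.foldl next d).conf.1 ∈ blockPDA.F := by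
  induction w generalizing d with
  | nil => exact nil_mem_residual_iff
  | cons x w ih => rw [cons_mem_residual_iff, ih, List.foldl_cons]

/-- The token with the number of blocks to be skipped replaced by `k`. -/
def setSkip : Tracker → ℕ → Tracker
  | skip _ inBlock, k => skip k inBlock
  | d, _ => d

theorem conf_setSkip (d : Tracker) (k : ℕ) : (d.setSkip k).conf = d.conf := by
  cases d <;> rfl

theorem exists_setSkip_next (d : Tracker) (x : Letter) (k : ℕ) :
    ∃ k', (d.setSkip k').next x = ((d.setSkip 1).next x).setSkip k := by
  rcases d with ⟨_, _ | _⟩ | _ | ⟨_ | _, _ | _⟩ | (_ | _) | _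
  case skip.false => exact ⟨k + 1, by cases x <;> rfl⟩
  case skip.true => exact ⟨k, by cases k <;> cases x <;> rfl⟩
  all_goals exact ⟨k, by cases x <;> rfl⟩

theorem residual_count_zero_subset : (count 0).residual ⊆ (skip 0 false).residual := by
  rintro _ ⟨l, ls, rfl⟩
  exact ⟨l :: ls, 0 + l, rfl, by simp⟩

theorem step_conf_next (hd : d ≠ skip 0 false) : blockPDA.Step d.conf (some x) (d.next x).conf := by
  rcases d with ⟨_ | k, _ | _⟩ | (_ | r) | ⟨_ | _, _ | r⟩ | (_ | r) | (_ | r) <;> cases x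
  all_goals first | exact absurd rfl hd | exact blockPDA_step_letter ..

theorem tokenMove_conf_next : blockPDA.TokenMove d.conf x (d.next x).conf := by
  by_cases hd : d = skip 0 false
  · subst hd
    have hnext : (skip 0 false).next x = (count 0).next x := by cases x <;> rfl
    rw [hnext]
    exact ⟨_, .single (.mk ⟨rfl, rfl⟩), step_conf_next (d := count 0) (by simp)⟩
  · exact ⟨_, .refl, step_conf_next hd⟩

theorem exists_eq_skip_of_step_none {c : PDA.Conf (Phase × Bool) (Option Bool)}
    (h : blockPDA.Step d.conf none c) : ∃ k, d = skip k false ∧ c = (count 0).conf := by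
  obtain ⟨hq, rfl⟩ := of_blockPDA_step_none h
  rcases d with ⟨k, _ | _⟩ | _ | _ | _ | _
  case skip.false => exact ⟨k, rfl, rfl⟩
  all_goals cases hq

theorem run_conf_foldl (d : Tracker) (w : List Letter) :
    blockPDA.Run d.conf w (w.foldl next d).conf := by
  induction w generalizing d with
  | nil => exact .refl _
  | cons x w ih => exact tokenMove_conf_next.run.trans (ih _)

theorem exists_mem_residual_setSkip {c e : PDA.Conf (Phase × Bool) (Option Bool)}
    (h : blockPDA.Run c w e) (hd : c = d.conf) (he : e.1 ∈ blockPDA.F) :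
    ∃ k, w ∈ (d.setSkip k).residual := by
  induction h generalizing d with
  | refl =>
    exact ⟨0, nil_mem_residual_iff.2 (by rwa [conf_setSkip, ← hd])⟩
  | eps h _ ih =>
    subst hd
    obtain ⟨k, rfl, rfl⟩ := exists_eq_skip_of_step_none h
    exact ⟨0, residual_count_zero_subset (ih (d := count 0) rfl he).choose_spec⟩
  | @read _ _ _ x _ h _ ih =>
    have hstep := step_conf_next (d := d.setSkip 1) (x := x) (by rcases d <;> simp [setSkip])
    rw [conf_setSkip, ← hd] at hstep
    obtain ⟨k, hk⟩ := ih (blockPDA_step_letter_unique h hstep) he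
    obtain ⟨k', hk'⟩ := exists_setSkip_next d _ k
    exact ⟨k', cons_mem_residual_iff.2 (by rwa [hk'])⟩

end Tracker

theorem language_blockPDA : blockPDA.language = Lblock := by
  ext w
  constructor
  · rintro ⟨e, h, he⟩
    obtain ⟨k, ls, m, rfl, hm⟩ := Tracker.exists_mem_residual_setSkip (d := .skip 0 false) h rfl he
    exact ⟨ls, m, List.mem_of_getElem? hm, rfl⟩
  · rintro ⟨ls, m, hm, rfl⟩
    obtain ⟨k, hk⟩ := List.mem_iff_getElem?.1 hm
    exact ⟨_, (Tracker.skip k false).run_conf_foldl _, Tracker.mem_residual_iff.1 ⟨ls, m, rfl, hk⟩⟩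

/-- The strategy in which token `i` skips `i` blocks and counts the next one. -/
def blockStrategy (n : ℕ) : PDA.Strategy (Phase × Bool) Letter (Option Bool) n :=
  fun w i => (w.foldl Tracker.next (.skip i false)).conf

theorem blockStrategy_fst_mem_iff {n : ℕ} {w : List Letter} {i : Fin n} :
    (blockStrategy n w i).1 ∈ blockPDA.F ↔
      ∃ ls m, w = blockWord ls m ∧ ls[(i : ℕ)]? = some m :=
  Tracker.mem_residual_iff.symm

theorem isWinning_blockStrategy (n : ℕ) : blockPDA.IsWinning n (blockStrategy n) where
  start _ := rfl
  move w x _ i := by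
    rw [blockStrategy, blockStrategy, List.foldl_append]
    exact Tracker.tokenMove_conf_next
  win w hw h := by
    rw [language_blockPDA] at h
    obtain ⟨ls, m, hm, rfl⟩ := h
    obtain ⟨i, hi⟩ := List.mem_iff_getElem?.1 hm
    have hin : i < n := calc
      i < ls.length := (List.getElem?_eq_some_iff.1 hi).1
      _ ≤ (blockWord ls m).length := length_le_length_blockWord ls m
      _ ≤ n := hw
    exact ⟨⟨i, hin⟩, blockStrategy_fst_mem_iff.2 ⟨ls, m, rfl, hi⟩⟩

theorem ExplCFL_mono (A : Type) {C D : Set (ℕ → ℕ)} (h : C ⊆ D) : ExplCFL A C ⊆ ExplCFL A D :=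
  fun _ ⟨f, hf, hfC, hL⟩ => ⟨f, hf, h hfC, hL⟩

theorem BigO_one_subset_BigO_id : BigO (fun _ => 1) ⊆ BigO (fun n => n) := by
  intro f hf
  refine Asymptotics.IsBigO.trans hf (.of_bound' ?_)
  filter_upwards [Filter.eventually_ge_atTop 1] with n hn
  simpa using hn

theorem not_tendsto_atTop_of_mem_BigO_one {f : ℕ → ℕ} (hf : f ∈ BigO fun _ => 1) :
    ¬ Filter.Tendsto f Filter.atTop Filter.atTop := by
  have hbdd : Filter.IsBoundedUnder (· ≤ ·) Filter.atTop fun n => (f n : ℝ) := by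
    simpa [BigO, Asymptotics.isBigO_one_iff] using hf
  exact fun h => Filter.not_isBoundedUnder_of_tendsto_atTop
    (tendsto_natCast_atTop_atTop.comp h) hbdd

theorem Lblock_mem_ExplCFL {D : Set (ℕ → ℕ)} (hD : id ∈ D) : Lblock ∈ ExplCFL Letter D :=
  ⟨id, Computable.id, hD, _, _, inferInstance, inferInstance, blockPDA, language_blockPDA,
    fun n => ⟨_, isWinning_blockStrategy n⟩⟩

theorem Lblock_notMem_ExplCFL {C : Set (ℕ → ℕ)}
    (hC : ∀ f ∈ C, ¬ Filter.Tendsto f Filter.atTop Filter.atTop) : Lblock ∉ ExplCFL Letter C := by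
  rintro ⟨f, -, hfC, Q, G, _, _, P, hP, hf⟩
  exact hC f hfC (P.tendsto_atTop_of_isExplorable hP hf)

theorem mainTheorem4_general {C D : Set (ℕ → ℕ)} (hCD : C ⊆ D)
    (hC : ∀ f ∈ C, ¬ Filter.Tendsto f Filter.atTop Filter.atTop) (hD : id ∈ D) :
    (∀ A : Type, ExplCFL A C ⊆ ExplCFL A D) ∧
    ExplCFL Letter C ⊂ ExplCFL Letter D ∧
    Lblock ∈ ExplCFL Letter D ∧
    Lblock ∉ ExplCFL Letter C ∧
    (∃ (Q G : Type) (_ : Finite Q) (_ : Finite G) (P : PDA Q Letter G), P.language = Lblock ∧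
      ∀ n : ℕ, ∃ σ : PDA.Strategy Q Letter G n, P.IsWinning n σ ∧
        ∀ (w : List Letter) (i : Fin n),
          ((σ w i).1 ∈ P.F ↔
            ∃ (ls : List ℕ) (m : ℕ), w = blockWord ls m ∧ ls[(i : ℕ)]? = some m)) := by
  have hmem := Lblock_mem_ExplCFL hD
  have hnotMem := Lblock_notMem_ExplCFL hC
  have hsub (A : Type) : ExplCFL A C ⊆ ExplCFL A D := ExplCFL_mono A hCD
  have hssub : ExplCFL Letter C ⊂ ExplCFL Letter D := ⟨hsub Letter, fun h => hnotMem (h hmem)⟩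
  exact ⟨hsub, hssub, hmem, hnotMem, _, _, inferInstance, inferInstance, blockPDA,
    language_blockPDA, fun n => ⟨blockStrategy n, isWinning_blockStrategy n,
      fun _ _ => blockStrategy_fst_mem_iff⟩⟩

theorem mainTheorem4 :
    -- constant explorability is included in linear explorability, over every finite alphabet
    (∀ (A : Type) [Finite A], ExplCFL A (BigO fun _ => 1) ⊆ ExplCFL A (BigO fun n => n)) ∧
    -- the inclusion is strict, as is witnessed by `Lblock`
    ExplCFL Letter (BigO fun _ => 1) ⊂ ExplCFL Letter (BigO fun n => n) ∧
    Lblock ∈ ExplCFL Letter (BigO fun n => n) ∧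
    Lblock ∉ ExplCFL Letter (BigO fun _ => 1) ∧
    -- one token per block: with `n` tokens for words of length at most `n`, Determiner wins so that
    -- token `i` accepts exactly when the number of `b`s is the length of block `i`
    (∃ (Q G : Type) (_ : Finite Q) (_ : Finite G) (P : PDA Q Letter G), P.language = Lblock ∧
      ∀ n : ℕ, ∃ σ : PDA.Strategy Q Letter G n, P.IsWinning n σ ∧
        ∀ w : List Letter, w.length ≤ n → ∀ i : Fin n,
          ((σ w i).1 ∈ P.F ↔
            ∃ (ls : List ℕ) (m : ℕ), w = blockWord ls m ∧ ls[(i : ℕ)]? = some m)) := by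
  obtain ⟨hsub, hssub, hmem, hnotMem, Q, G, hQ, hG, P, hP, hσ⟩ := mainTheorem4_general
    BigO_one_subset_BigO_id (fun _ => not_tendsto_atTop_of_mem_BigO_one)
    (Asymptotics.isBigO_refl _ _ : id ∈ BigO fun n => n)
  refine ⟨fun A _ => hsub A, hssub, hmem, hnotMem, Q, G, hQ, hG, P, hP, fun n => ?_⟩
  obtain ⟨σ, hwin, haccept⟩ := hσ n
  exact ⟨σ, hwin, fun w _ => haccept w⟩
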